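/- For partitions $\mu\subseteq\lambda$ and $n\ge 0$, let $s_{\lambda/\mu}(x_1,\dots,x_n)=\sum_T\prod_i x_i^{\#i\text{'s in }T}\in\mathbb{C}[x_1,\dots,x_n]$ be the skew Schur polynomial, the sum being over all fillings $T$ of the skew diagram $\lambda/\mu$ with entries from $\{1,\dots,n\}$ that increase weakly along rows and strictly down columns. For a nonzero polynomial $f=\sum_i c_i x^i$ over $\mathbb{C}$, let $\mathrm{Trop}(f)=\max_{i:\,c_i\neq 0}(i_1x_1+\cdots+i_nx_n)$, regarded as a formal polynomial over the tropical semiring $(\mathbb{R},\oplus,\odot)$, where $a\oplus b=\max(a,b)$ and $a\odot b=a+b$. A tropical arithmetic circuit is an acyclic circuit whose inputs are each labelled by a variable $x_i$ or a real constant, in which each gate performs a single binary operation $\oplus$ or $\odot$ (results may be reused), and which has one output. It evaluates a tropical polynomial $p$ if its output equals $p$ as a formal tropical polynomial, i.e. if the equality follows from the commutative semiring axioms, idempotence $a\oplus a=a$ and the arithmetic of the constants. The tropical semiring complexity of $p$ is the smallest number of gates (inputs are not counted) in a circuit evaluating $p$. Then $\mathrm{Trop}(s_{\lambda/\mu}(x_1,\dots,x_n))$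 has tropical semiring complexity $O(n^2\cdot\lambda_1)$: there is an absolute constant $C$ such that for all $n\ge 0$ and all partitions $\mu\subseteq\lambda$ with $s_{\lambda/\mu}(x_1,\dots,x_n)\neq 0$, some circuit with at most $C\,n^2\,\lambda_1$ gates evaluates $\mathrm{Trop}(s_{\lambda/\mu}(x_1,\dots,x_n))$. (Here $\lambda_1$ is the largest part of $\lambda$, with $\lambda_1=0$ if $\lambda=\emptyset$.) -/

import Mathlib

namespace TropicalComplexity

noncomputable section

/-! ### Skew Schur polynomials

Partitions are identified with their Young diagrams (`YoungDiagram`); the part `λ₁` of the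
partition `lam` is `lam.rowLen 0`.  A box is a pair (row, column), rows counted from the top. -/

/-- The boxes of the skew diagram `lam / mu` (used for `mu ≤ lam`, that is, `mu ⊆ lam`). -/
abbrev skewCells (lam mu : YoungDiagram) : Finset (ℕ × ℕ) := lam.cells \ mu.cells

/-- A filling of the boxes of `lam / mu` with entries from `{1, …, n}` (modelled by `Fin n`) is
semistandard if it is weakly increasing along rows and strictly increasing down columns. -/
def IsSemistandard {n : ℕ} {lam mu : YoungDiagram} (T : skewCells lam mu → Fin n) : Prop :=
  (∀ b c : skewCells lam mu, b.1.1 = c.1.1 → b.1.2 < c.1.2 → T b ≤ T c) ∧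
  (∀ b c : skewCells lam mu, b.1.2 = c.1.2 → b.1.1 < c.1.1 → T b < T c)

open Classical in
/-- The skew Schur polynomial `s_{lam/mu}(x₁, …, xₙ) = ∑ T, x^T` over all semistandard fillings
`T` of `lam / mu` with entries from `{1, …, n}`, with `x^T = ∏ i, x_i ^ (number of i's in T)`. -/
def skewSchur (n : ℕ) (lam mu : YoungDiagram) : MvPolynomial (Fin n) ℂ :=
  ∑ T : skewCells lam mu → Fin n with IsSemistandard T,
    ∏ i : Fin n, MvPolynomial.X i ^ (Finset.univ.filter (fun b => T b = i)).card

/-! ### Tropical polynomials -/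

/-- The max-plus semiring `ℝ ∪ {-∞}`: addition is `max`, multiplication is the addition of reals.
(Mathlib's `Tropical` is the min-plus convention, so the order of `ℝ` is reversed; the element
`⊤` of `WithTop ℝᵒᵈ` is `-∞`.) -/
abbrev MaxPlus : Type := Tropical (WithTop ℝᵒᵈ)

/-- The real number `c` as an element of the max-plus semiring. -/
def MaxPlus.ofReal (c : ℝ) : MaxPlus :=
  Tropical.trop ((OrderDual.toDual c : ℝᵒᵈ) : WithTop ℝᵒᵈ)

/-- Formal tropical polynomials in `x₁, …, xₙ`.  This is the free commutative algebra over the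
(idempotent) max-plus semiring, so that two expressions in variables and constants give the same
element exactly when their equality follows from the commutative semiring axioms, idempotence
`a ⊕ a = a`, and the arithmetic of the constants.  This is finer than equality as functions. -/
abbrev TropPoly (n : ℕ) : Type := MvPolynomial (Fin n) MaxPlus

/-- The tropicalization of `f` with respect to the trivial valuation: the tropical sum (maximum),
over the exponent vectors `m` of `f` with nonzero coefficient, of the tropical monomials
`x^m` (that is, `m₁ x₁ + ⋯ + mₙ xₙ`), each with coefficient the tropical unit (the real `0`). -/
def trop {n : ℕ} (f : MvPolynomial (Fin n) ℂ) : TropPoly n :=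
  ∑ m ∈ f.support, MvPolynomial.monomial m 1

/-! ### Arithmetic circuits over the tropical semiring -/

/-- What may be fed into a gate when `k` gates are available: an input, labelled by a variable
or by a real constant, or the result of one of these `k` gates. -/
inductive Wire (n k : ℕ) : Type
  | var (i : Fin n) : Wire n k
  | const (c : ℝ) : Wire n k
  | gate (g : Fin k) : Wire n k

/-- The two kinds of gates: tropical addition and tropical multiplication. -/
inductive Op : Type
  | add : Op
  | mul : Op

/-- The operation carried out by a gate. -/
def Op.apply {R : Type*} [Add R] [Mul R] : Op → R → R → R
  | Op.add, a, b => a + b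
  | Op.mul, a, b => a * b

/-- The gates of an acyclic circuit, listed in a topological order: a list of `k` gates, each of
which takes two arguments from the inputs and the earlier gates (results may be reused). -/
inductive Gates (n : ℕ) : ℕ → Type
  | nil : Gates n 0
  | snoc {k : ℕ} (G : Gates n k) (op : Op) (a b : Wire n k) : Gates n (k + 1)

/-- The tropical polynomial on a wire, given the results of the gates. -/
def Wire.eval {n k : ℕ} (v : Fin k → TropPoly n) : Wire n k → TropPoly n
  | Wire.var i => MvPolynomial.X i
  | Wire.const c => MvPolynomial.C (MaxPlus.ofReal c)
  | Wire.gate g => v g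

/-- The tropical polynomials computed by the gates. -/
def Gates.eval {n : ℕ} : {k : ℕ} → Gates n k → Fin k → TropPoly n
  | _, Gates.nil => Fin.elim0
  | _, Gates.snoc G op a b =>
      Fin.snoc (α := fun _ => TropPoly n) G.eval (op.apply (a.eval G.eval) (b.eval G.eval))

/-- An arithmetic circuit in the variables `x₁, …, xₙ` with one output. -/
structure Circuit (n : ℕ) : Type where
  /-- the number of gates; inputs are not counted -/
  size : ℕ
  gates : Gates n size
  output : Wire n size

/-- The tropical polynomial computed by a circuit. -/
def Circuit.res {n : ℕ} (K : Circuit n) : TropPoly n := K.output.eval K.gates.eval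

/-- The tropical semiring complexity of `p`: the smallest number of gates in a circuit that
evaluates `p` (`⊤` if there is no such circuit). -/
def complexity {n : ℕ} (p : TropPoly n) : ℕ∞ :=
  ⨅ (K : Circuit n) (_ : K.res = p), (K.size : ℕ∞)

end

end TropicalComplexity

/-!
The circuit rests on a factorization of formal tropical polynomials,
`Trop(s_{lam/mu}) = ∏ⱼ Trop(e_{cⱼ})` (`trop_skewSchur`), where `cⱼ` is the length of column `j` of
`lam / mu` and `e_c` is the elementary symmetric polynomial in `x₁, …, xₙ`.  The coefficients of
`s_{lam/mu}` count fillings, so nothing cancels, and since tropical addition is idempotent, it is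
enough that both sides have the same monomials.  The monomials on the right are those of the
fillings that increase strictly down columns, with no condition on the rows.  Sorting every row of
such a filling keeps its monomial, and it also keeps the columns strict
(`IsColumnStrict.isSemistandard_comp`), so the monomials agree with those of the semistandard
fillings.

The recursion `e_k(s ∪ {a}) = e_k(s) + x_a e_{k-1}(s)` computes all `e_k` with `k ≤ n` at once with
at most `2 n²` gates (`computable_tropEsymm`), and the product over the columns needs at most
`λ₁` further gates.  If the skew Schur polynomial is nonzero, every column has length at most `n`.
-/

namespace TropicalComplexity

open Finset MvPolynomial

/-! ### Sums over an idempotent addition -/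

lemma TropPoly.add_self {n : ℕ} (p : TropPoly n) : p + p = p := by
  ext m
  rw [coeff_add, Tropical.add_self]

lemma sum_eq_sum_image_of_idempotent {M ι : Type*} [AddCommMonoid M] [DecidableEq M]
    (idem : ∀ a : M, a + a = a) (s : Finset ι) (f : ι → M) :
    ∑ a ∈ s, f a = ∑ y ∈ s.image f, y := by
  classical
  induction s using Finset.induction_on with
  | empty => simp
  | insert a s ha ih =>
    rw [Finset.sum_insert ha, ih, Finset.image_insert]
    by_cases hy : f a ∈ s.image f
    · rw [Finset.insert_eq_of_mem hy, ← Finset.add_sum_erase _ _ hy, ← add_assoc, idem]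
    · rw [Finset.sum_insert hy]

/-- Where addition is idempotent, a sum depends only on the set of its summands. -/
lemma sum_eq_sum_of_idempotent {M ι κ : Type*} [AddCommMonoid M] (idem : ∀ a : M, a + a = a)
    {s : Finset ι} {t : Finset κ} {f : ι → M} {g : κ → M}
    (hfg : ∀ a ∈ s, ∃ b ∈ t, g b = f a) (hgf : ∀ b ∈ t, ∃ a ∈ s, f a = g b) :
    ∑ a ∈ s, f a = ∑ b ∈ t, g b := by
  classical
  rw [sum_eq_sum_image_of_idempotent idem s f, sum_eq_sum_image_of_idempotent idem t g]
  congr 1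
  ext y
  simp only [Finset.mem_image]
  constructor
  · rintro ⟨a, ha, rfl⟩
    exact hfg a ha
  · rintro ⟨b, hb, rfl⟩
    exact hgf b hb

/-! ### Circuits that compute several polynomials -/

/-- `Computable N S` says that some list of at most `N` gates makes every polynomial of the set `S`
available on a wire (an input or the result of a gate). -/
def Computable {n : ℕ} (N : ℕ) (S : Set (TropPoly n)) : Prop :=
  ∃ k ≤ N, ∃ G : Gates n k, ∀ p ∈ S, ∃ w : Wire n k, w.eval G.eval = p

lemma Computable.mono {n N N' : ℕ} {S S' : Set (TropPoly n)} (h : Computable N S) (hN : N ≤ N')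
    (hS : S' ⊆ S) : Computable N' S' := by
  obtain ⟨k, hk, G, hG⟩ := h
  exact ⟨k, hk.trans hN, G, fun p hp => hG p (hS hp)⟩

lemma Computable.empty {n : ℕ} : Computable 0 (∅ : Set (TropPoly n)) :=
  ⟨0, le_rfl, Gates.nil, by simp⟩

lemma Computable.insert_X {n N : ℕ} {S : Set (TropPoly n)} (h : Computable N S) (i : Fin n) :
    Computable N (insert (X i) S) := by
  obtain ⟨k, hk, G, hG⟩ := h
  refine ⟨k, hk, G, ?_⟩
  rintro p (rfl | hp)
  · exact ⟨Wire.var i, rfl⟩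
  · exact hG p hp

/-- The tropical unit is the real constant `0`. -/
lemma Computable.insert_one {n N : ℕ} {S : Set (TropPoly n)} (h : Computable N S) :
    Computable N (insert 1 S) := by
  obtain ⟨k, hk, G, hG⟩ := h
  refine ⟨k, hk, G, ?_⟩
  rintro p (rfl | hp)
  · exact ⟨Wire.const 0, map_one C⟩
  · exact hG p hp

/-- A wire of a list of gates, as a wire of the list with one gate appended. -/
def Wire.lift {n k : ℕ} : Wire n k → Wire n (k + 1)
  | Wire.var i => Wire.var i
  | Wire.const c => Wire.const c
  | Wire.gate g => Wire.gate g.castSucc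

lemma Wire.eval_lift {n k : ℕ} (G : Gates n k) (op : Op) (a b w : Wire n k) :
    w.lift.eval (G.snoc op a b).eval = w.eval G.eval := by
  cases w <;> simp [Wire.lift, Wire.eval, Gates.eval]

lemma Computable.insert_op {n N : ℕ} {S : Set (TropPoly n)} (h : Computable N S) (op : Op)
    {p q : TropPoly n} (hp : p ∈ S) (hq : q ∈ S) :
    Computable (N + 1) (insert (op.apply p q) S) := by
  obtain ⟨k, hk, G, hG⟩ := h
  obtain ⟨a, rfl⟩ := hG p hp
  obtain ⟨b, rfl⟩ := hG q hq
  refine ⟨k + 1, by omega, G.snoc op a b, ?_⟩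
  rintro r (rfl | hr)
  · exact ⟨Wire.gate (Fin.last k), by simp [Wire.eval, Gates.eval]⟩
  · obtain ⟨w, hw⟩ := hG r hr
    exact ⟨w.lift, by rw [Wire.eval_lift, hw]⟩

lemma Computable.insert_add {n N : ℕ} {S : Set (TropPoly n)} (h : Computable N S)
    {p q : TropPoly n} (hp : p ∈ S) (hq : q ∈ S) : Computable (N + 1) (insert (p + q) S) :=
  h.insert_op Op.add hp hq

lemma Computable.insert_mul {n N : ℕ} {S : Set (TropPoly n)} (h : Computable N S)
    {p q : TropPoly n} (hp : p ∈ S) (hq : q ∈ S) : Computable (N + 1) (insert (p * q) S) :=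
  h.insert_op Op.mul hp hq

lemma Computable.insert_prod {n N l : ℕ} {S : Set (TropPoly n)} (h : Computable N S)
    (f : Fin l → TropPoly n) (hf : ∀ j, f j ∈ S) :
    Computable (N + l) (insert (∏ j, f j) S) := by
  induction l with
  | zero => simpa using h.insert_one
  | succ l ih =>
    have h' := ih (fun j => f j.castSucc) (fun j => hf _)
    rw [Fin.prod_univ_castSucc]
    exact (h'.insert_mul (Set.mem_insert _ _) (Set.mem_insert_of_mem _ (hf (Fin.last l)))).mono
      (by omega) (Set.insert_subset_insert (Set.subset_insert _ _))

lemma complexity_le_of_computable {n N : ℕ} {p : TropPoly n} {S : Set (TropPoly n)}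
    (h : Computable N S) (hp : p ∈ S) : complexity p ≤ (N : ℕ∞) := by
  obtain ⟨k, hk, G, hG⟩ := h
  obtain ⟨w, hw⟩ := hG p hp
  calc complexity p ≤ ((⟨k, G, w⟩ : Circuit n).size : ℕ∞) := iInf₂_le (⟨k, G, w⟩ : Circuit n) hw
    _ ≤ N := by exact_mod_cast hk

/-! ### Elementary symmetric polynomials -/

/-- The tropical elementary symmetric polynomial of degree `k` in the variables `x_i`, `i ∈ s`. -/
noncomputable def tropEsymm {n : ℕ} (s : Finset (Fin n)) (k : ℕ) : TropPoly n :=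
  ∑ A ∈ s.powersetCard k, ∏ i ∈ A, X i

lemma tropEsymm_zero {n : ℕ} (s : Finset (Fin n)) : tropEsymm s 0 = 1 := by
  simp [tropEsymm]

lemma tropEsymm_insert_succ {n : ℕ} {s : Finset (Fin n)} {a : Fin n} (ha : a ∉ s) (k : ℕ) :
    tropEsymm (insert a s) (k + 1) = tropEsymm s (k + 1) + X a * tropEsymm s k := by
  have hnot : ∀ {A : Finset (Fin n)}, A ∈ s.powersetCard k → a ∉ A := fun hA h =>
    ha ((Finset.mem_powersetCard.1 hA).1 h)
  unfold tropEsymm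
  rw [Finset.powersetCard_succ_insert ha, Finset.sum_union, Finset.sum_image, Finset.mul_sum]
  · congr 1
    exact Finset.sum_congr rfl fun A hA => Finset.prod_insert (hnot hA)
  · intro A hA B hB hAB
    rw [← Finset.erase_insert (hnot hA), hAB, Finset.erase_insert (hnot hB)]
  · rw [Finset.disjoint_left]
    intro A hA hA'
    obtain ⟨B, -, rfl⟩ := Finset.mem_image.1 hA'
    exact ha ((Finset.mem_powersetCard.1 hA).1 (Finset.mem_insert_self _ _))

lemma tropEsymm_insert_card {n : ℕ} {s : Finset (Fin n)} {a : Fin n} (ha : a ∉ s) :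
    tropEsymm (insert a s) (s.card + 1) = X a * tropEsymm s s.card := by
  rw [tropEsymm_insert_succ ha]
  simp [tropEsymm, Finset.powersetCard_eq_empty.2 (Nat.lt_succ_self s.card)]

/-- Passing from the variables in `s` to one more variable takes two gates for each degree. -/
lemma computable_tropEsymm {n : ℕ} (s : Finset (Fin n)) :
    Computable (2 * s.card ^ 2) {p | ∃ k ≤ s.card, p = tropEsymm s k} := by
  induction s using Finset.induction_on with
  | empty =>
    refine Computable.empty.insert_one.mono (by simp) ?_
    rintro p ⟨k, hk, rfl⟩
    obtain rfl : k = 0 := by simpa using hk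
    simp [tropEsymm_zero]
  | insert a s ha ih =>
    have step : ∀ d ≤ s.card + 1, Computable (2 * s.card ^ 2 + 2 * d)
        (insert (X a) {p | ∃ k ≤ s.card, p = tropEsymm s k} ∪
          {p | ∃ k ≤ d, p = tropEsymm (insert a s) k}) := by
      intro d
      induction d with
      | zero =>
        intro _
        refine ((ih.insert_X a).insert_one).mono (by omega) ?_
        rintro p (hp | ⟨k, hk, rfl⟩)
        · exact Set.mem_insert_of_mem _ hp
        · obtain rfl : k = 0 := by omega
          exact Or.inl (tropEsymm_zero _)
      | succ d ihd =>
        intro hd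
        have h1 := (ihd (by omega)).insert_mul (p := X a) (q := tropEsymm s d)
          (Or.inl (Or.inl rfl)) (Or.inl (Or.inr ⟨d, by omega, rfl⟩))
        have new : Computable (2 * s.card ^ 2 + 2 * (d + 1))
            (insert (tropEsymm (insert a s) (d + 1))
              (insert (X a) {p | ∃ k ≤ s.card, p = tropEsymm s k} ∪
                {p | ∃ k ≤ d, p = tropEsymm (insert a s) k})) := by
          rcases Nat.lt_or_ge d s.card with hlt | hge
          · rw [tropEsymm_insert_succ ha]
            exact (h1.insert_add (p := tropEsymm s (d + 1)) (q := X a * tropEsymm s d)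
              (Or.inr (Or.inl (Or.inr ⟨d + 1, hlt, rfl⟩))) (Or.inl rfl)).mono (by omega)
              (Set.insert_subset_insert (Set.subset_insert _ _))
          · -- in top degree only the products containing `X a` occur
            obtain rfl : d = s.card := by omega
            rw [tropEsymm_insert_card ha]
            exact h1.mono (by omega) le_rfl
        refine new.mono le_rfl ?_
        rintro p (hp | ⟨k, hk, rfl⟩)
        · exact Or.inr (Or.inl hp)
        · rcases Nat.lt_or_ge d k with hlt | hge
          · obtain rfl : k = d + 1 := by omega
            exact Or.inl rfl
          · exact Or.inr (Or.inr ⟨k, hge, rfl⟩)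
    rw [Finset.card_insert_of_notMem ha]
    exact (step (s.card + 1) le_rfl).mono (by nlinarith) Set.subset_union_right

/-! ### Sorting the rows of a filling -/

section Fillings

variable {n : ℕ} {lam mu : YoungDiagram}

/-- A filling is column-strict if it increases strictly down the columns. -/
def IsColumnStrict (T : skewCells lam mu → Fin n) : Prop :=
  ∀ b c : skewCells lam mu, b.1.2 = c.1.2 → b.1.1 < c.1.1 → T b < T c

lemma mem_skewCells {r c : ℕ} :
    (r, c) ∈ skewCells lam mu ↔ mu.rowLen r ≤ c ∧ c < lam.rowLen r := by
  rw [skewCells, Finset.mem_sdiff, YoungDiagram.mem_cells, YoungDiagram.mem_cells,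
    YoungDiagram.mem_iff_lt_rowLen, YoungDiagram.mem_iff_lt_rowLen, not_lt, and_comm]

/-- Each row can be sorted: among the row-preserving permutations, one that maximizes the sum of
(column index) × (entry) leaves no descent in a row. -/
lemma exists_perm_rowSorted (T : skewCells lam mu → Fin n) :
    ∃ σ : Equiv.Perm (skewCells lam mu), (∀ b, (σ b).1.1 = b.1.1) ∧
      ∀ b c : skewCells lam mu, b.1.1 = c.1.1 → b.1.2 < c.1.2 → T (σ b) ≤ T (σ c) := by
  classical
  obtain ⟨σ, hσ, hmax⟩ := Finset.exists_max_image
    (Finset.univ.filter fun σ : Equiv.Perm (skewCells lam mu) => ∀ b, (σ b).1.1 = b.1.1)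
    (fun σ => ∑ b, b.1.2 * (T (σ b)).val) ⟨1, by simp⟩
  have hrow : ∀ b, (σ b).1.1 = b.1.1 := (Finset.mem_filter.1 hσ).2
  refine ⟨σ, hrow, fun b c hbc hlt => ?_⟩
  by_contra hcon
  have hne : b ≠ c := by
    rintro rfl
    exact lt_irrefl _ hlt
  have hle := hmax ((Equiv.swap b c).trans σ) (by
    refine Finset.mem_filter.2 ⟨Finset.mem_univ _, fun d => ?_⟩
    rw [Equiv.trans_apply, hrow]
    rcases eq_or_ne d b with rfl | hdb
    · rw [Equiv.swap_apply_left, hbc]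
    · rcases eq_or_ne d c with rfl | hdc
      · rw [Equiv.swap_apply_right, hbc]
      · rw [Equiv.swap_apply_of_ne_of_ne hdb hdc])
  have hc : c ∈ Finset.univ.erase b := Finset.mem_erase.2 ⟨hne.symm, Finset.mem_univ _⟩
  have hrest : ∑ d ∈ (Finset.univ.erase b).erase c,
      d.1.2 * (T (((Equiv.swap b c).trans σ) d)).val =
      ∑ d ∈ (Finset.univ.erase b).erase c, d.1.2 * (T (σ d)).val := by
    refine Finset.sum_congr rfl fun d hd => ?_
    have h1 := Finset.mem_erase.1 hd
    rw [Equiv.trans_apply, Equiv.swap_apply_of_ne_of_ne (Finset.mem_erase.1 h1.2).1 h1.1]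
  simp only [← Finset.add_sum_erase _ _ (Finset.mem_univ b), ← Finset.add_sum_erase _ _ hc] at hle
  rw [hrest] at hle
  simp only [Equiv.trans_apply, Equiv.swap_apply_left, Equiv.swap_apply_right] at hle
  have hval : (T (σ c)).val < (T (σ b)).val := not_le.1 hcon
  nlinarith

/-- Sorting the rows of a column-strict filling keeps it column-strict.  Let `v` be the entry in
column `k` of the lower row after sorting.  At least `k + 1 - mu_{r'}` entries of the lower row `r'`
are at most `v`; of these, all but `mu_r - mu_{r'}` lie below a box of the upper row `r`, whose
entry is then smaller than `v`.  So at least `k + 1 - mu_r` entries of the upper row are smaller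
than `v`, and after sorting they reach column `k`. -/
lemma IsColumnStrict.isSemistandard_comp {T : skewCells lam mu → Fin n} (hT : IsColumnStrict T)
    {σ : Equiv.Perm (skewCells lam mu)} (hrow : ∀ b, (σ b).1.1 = b.1.1)
    (hsort : ∀ b c : skewCells lam mu, b.1.1 = c.1.1 → b.1.2 < c.1.2 → T (σ b) ≤ T (σ c)) :
    IsSemistandard (T ∘ σ) := by
  classical
  refine ⟨hsort, ?_⟩
  rintro ⟨⟨r, k⟩, hb⟩ ⟨⟨r', k'⟩, hc⟩ hk hr
  obtain rfl : k = k' := hk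
  replace hr : r < r' := hr
  simp only [Function.comp_apply]
  have hb' := mem_skewCells.1 hb
  have hc' := mem_skewCells.1 hc
  have hmu : mu.rowLen r' ≤ mu.rowLen r := mu.rowLen_anti _ _ hr.le
  have hlam : lam.rowLen r' ≤ lam.rowLen r := lam.rowLen_anti _ _ hr.le
  by_contra hcon
  rw [not_lt] at hcon
  set v := T (σ ⟨(r', k), hc⟩) with hv
  let A : Finset (skewCells lam mu) := Finset.univ.filter fun b => b.1.1 = r ∧ T b < v
  let B : Finset (skewCells lam mu) := Finset.univ.filter fun b => b.1.1 = r' ∧ T b ≤ v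
  have hA : A.card ≤ k - mu.rowLen r := by
    rw [← Nat.card_Ico]
    refine Finset.card_le_card_of_injOn (fun b => (σ.symm b).1.2) ?_ ?_
    · intro b hbA
      obtain ⟨hbr, hbv⟩ := (Finset.mem_filter.1 hbA).2
      obtain ⟨d, rfl⟩ := σ.surjective b
      rw [hrow] at hbr
      obtain ⟨⟨r₁, k₁⟩, hd⟩ := d
      obtain rfl : r₁ = r := hbr
      simp only [Equiv.symm_apply_apply, Finset.coe_Ico, Set.mem_Ico]
      refine ⟨(mem_skewCells.1 hd).1, ?_⟩
      by_contra hk₁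
      rcases (not_lt.1 hk₁).eq_or_lt with rfl | hlt
      · exact absurd hbv (not_lt.2 hcon)
      · exact absurd hbv (not_lt.2 (hcon.trans (hsort ⟨(r₁, k), hb⟩ ⟨(r₁, k₁), hd⟩ rfl hlt)))
    · intro b hbA d hdA hbd
      have h1 := (Finset.mem_filter.1 hbA).2.1
      have h2 := (Finset.mem_filter.1 hdA).2.1
      refine σ.symm.injective (Subtype.ext (Prod.ext ?_ hbd))
      rw [← hrow (σ.symm b), ← hrow (σ.symm d), Equiv.apply_symm_apply, Equiv.apply_symm_apply,
        h1, h2]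
  have hB : k + 1 - mu.rowLen r' ≤ B.card := by
    rw [← Nat.card_Ico, ← Finset.card_attach]
    have hmem : ∀ j : ↥(Finset.Ico (mu.rowLen r') (k + 1)), (r', j.1) ∈ skewCells lam mu := by
      intro j
      have := Finset.mem_Ico.1 j.2
      exact mem_skewCells.2 ⟨this.1, by omega⟩
    refine Finset.card_le_card_of_injOn (fun j => σ ⟨(r', j.1), hmem j⟩) ?_ ?_
    · intro j _
      refine Finset.mem_coe.2 (Finset.mem_filter.2 ⟨Finset.mem_univ _, hrow _, ?_⟩)
      have hj := Finset.mem_Ico.1 j.2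
      rcases (Nat.lt_succ_iff.1 hj.2).eq_or_lt with h | h
      · exact le_of_eq (by simp only [hv, h])
      · exact hsort ⟨(r', j.1), hmem j⟩ ⟨(r', k), hc⟩ rfl h
    · intro i _ j _ hij
      have := σ.injective hij
      simp only [Subtype.mk.injEq, Prod.mk.injEq, true_and] at this
      exact Subtype.ext this
  have hBA : B.card ≤ (mu.rowLen r - mu.rowLen r') + A.card := by
    have hinj : Set.InjOn (fun b : skewCells lam mu => b.1.2) B := by
      intro b hbB d hdB hbd
      refine Subtype.ext (Prod.ext ?_ hbd)
      rw [(Finset.mem_filter.1 hbB).2.1, (Finset.mem_filter.1 hdB).2.1]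
    rw [← Finset.card_image_of_injOn hinj, ← Nat.card_Ico]
    refine (Finset.card_le_card (t := Finset.Ico (mu.rowLen r') (mu.rowLen r) ∪
      A.image fun b => b.1.2) ?_).trans
      ((Finset.card_union_le _ _).trans (Nat.add_le_add_left Finset.card_image_le _))
    intro j hj
    obtain ⟨⟨⟨r₁, j₁⟩, hd⟩, hdB, rfl⟩ := Finset.mem_image.1 hj
    obtain ⟨hr₁, hdv⟩ := (Finset.mem_filter.1 hdB).2
    obtain rfl : r₁ = r' := hr₁
    have hd' := mem_skewCells.1 hd
    rw [Finset.mem_union]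
    rcases Nat.lt_or_ge j₁ (mu.rowLen r) with hlt | hge
    · exact Or.inl (Finset.mem_Ico.2 ⟨hd'.1, hlt⟩)
    · have hup : (r, j₁) ∈ skewCells lam mu := mem_skewCells.2 ⟨hge, by omega⟩
      refine Or.inr (Finset.mem_image.2 ⟨⟨(r, j₁), hup⟩, ?_, rfl⟩)
      exact Finset.mem_filter.2 ⟨Finset.mem_univ _, rfl,
        (hT ⟨(r, j₁), hup⟩ ⟨_, hd⟩ rfl hr).trans_le hdv⟩
  omega

/-! ### Columns of a filling -/

variable (lam mu) in
/-- The rows that meet column `j` of the skew diagram `lam / mu`. -/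
def columnRows (j : ℕ) : Finset ℕ :=
  ((skewCells lam mu).filter fun b => b.2 = j).image Prod.fst

lemma mem_columnRows {j r : ℕ} : r ∈ columnRows lam mu j ↔ (r, j) ∈ skewCells lam mu := by
  rw [columnRows, Finset.mem_image]
  constructor
  · rintro ⟨⟨r', j'⟩, hb, rfl⟩
    obtain ⟨h, rfl⟩ := Finset.mem_filter.1 hb
    exact h
  · exact fun h => ⟨(r, j), Finset.mem_filter.2 ⟨h, rfl⟩, rfl⟩

lemma prod_skewCells {M : Type*} [CommMonoid M] (F : skewCells lam mu → M) :
    ∏ b, F b = ∏ j : Fin (lam.rowLen 0), ∏ r : columnRows lam mu j,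
      F ⟨(r.1, j.1), mem_columnRows.1 r.2⟩ := by
  rw [← Fintype.prod_sigma' (f := fun (j : Fin (lam.rowLen 0)) (r : columnRows lam mu j) =>
    F ⟨(r.1, j.1), mem_columnRows.1 r.2⟩)]
  symm
  refine Fintype.prod_bijective
    (fun x : (Σ j : Fin (lam.rowLen 0), columnRows lam mu j) =>
      (⟨(x.2.1, x.1.1), mem_columnRows.1 x.2.2⟩ : skewCells lam mu)) ⟨?_, ?_⟩ _ _ (fun _ => rfl)
  · rintro ⟨⟨j, hj⟩, ⟨r, hr⟩⟩ ⟨⟨j', hj'⟩, ⟨r', hr'⟩⟩ h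
    simp only [Subtype.mk.injEq, Prod.mk.injEq] at h
    obtain ⟨rfl, rfl⟩ := h
    rfl
  · rintro ⟨⟨r, j⟩, hb⟩
    have hj : j < lam.rowLen 0 :=
      (mem_skewCells.1 hb).2.trans_le (lam.rowLen_anti _ _ (Nat.zero_le r))
    exact ⟨⟨⟨j, hj⟩, ⟨r, mem_columnRows.2 hb⟩⟩, rfl⟩

/-- The set of entries in each column of a column-strict filling. -/
lemma IsColumnStrict.exists_columnSets {T : skewCells lam mu → Fin n} (hT : IsColumnStrict T) :
    ∃ S : Fin (lam.rowLen 0) → Finset (Fin n),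
      (∀ j, (S j).card = (columnRows lam mu j).card) ∧
      ∏ b, (X (T b) : TropPoly n) = ∏ j, ∏ i ∈ S j, X i := by
  classical
  have hinj : ∀ j : ℕ, Function.Injective fun r : columnRows lam mu j =>
      T ⟨(r.1, j), mem_columnRows.1 r.2⟩ := fun j =>
    StrictMono.injective fun r r' hrr' => hT _ _ rfl hrr'
  refine ⟨fun j => Finset.univ.image fun r : columnRows lam mu j =>
    T ⟨(r.1, j), mem_columnRows.1 r.2⟩, fun j => ?_, ?_⟩
  · rw [Finset.card_image_of_injective _ (hinj j), Finset.card_univ, Fintype.card_coe]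
  · rw [prod_skewCells]
    exact Finset.prod_congr rfl fun j _ => (Finset.prod_image (hinj j).injOn).symm

/-- Sets of the right sizes, written in increasing order into the columns. -/
lemma exists_isColumnStrict (S : Fin (lam.rowLen 0) → Finset (Fin n))
    (hS : ∀ j, (S j).card = (columnRows lam mu j).card) :
    ∃ T : skewCells lam mu → Fin n, IsColumnStrict T ∧
      ∏ b, (X (T b) : TropPoly n) = ∏ j, ∏ i ∈ S j, X i := by
  have hcol : ∀ b : skewCells lam mu, b.1.2 < lam.rowLen 0 := fun b =>
    (mem_skewCells.1 b.2).2.trans_le (lam.rowLen_anti _ _ (Nat.zero_le b.1.1))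
  let e : ∀ j : Fin (lam.rowLen 0), columnRows lam mu j ≃o S j := fun j =>
    ((columnRows lam mu j).orderIsoOfFin rfl).symm.trans ((S j).orderIsoOfFin (hS j))
  refine ⟨fun b => (e ⟨b.1.2, hcol b⟩ ⟨b.1.1, mem_columnRows.2 b.2⟩).1, ?_, ?_⟩
  · rintro ⟨⟨r, j⟩, hb⟩ ⟨⟨r', j'⟩, hc⟩ hj hr
    obtain rfl : j = j' := hj
    exact (e ⟨j, _⟩).strictMono hr
  · rw [prod_skewCells]
    refine Finset.prod_congr rfl fun j _ => ?_
    rw [← Finset.prod_coe_sort (S j) fun i => (X i : TropPoly n)]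
    exact Equiv.prod_comp (e j).toEquiv fun i => (X i.1 : TropPoly n)

/-! ### The tropicalization as a product over columns -/

/-- The exponent vector of the monomial of a filling. -/
noncomputable def content (T : skewCells lam mu → Fin n) : Fin n →₀ ℕ :=
  ∑ b, Finsupp.single (T b) 1

lemma prod_X_eq_monomial {R : Type*} [CommSemiring R] (T : skewCells lam mu → Fin n) :
    ∏ b, (X (T b) : MvPolynomial (Fin n) R) = monomial (content T) 1 := by
  rw [content, monomial_sum_one]
  rfl

open Classical in
lemma skewSchur_eq_sum_monomial :
    skewSchur n lam mu =
      ∑ T : skewCells lam mu → Fin n with IsSemistandard T, monomial (content T) 1 := by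
  refine Finset.sum_congr rfl fun T _ => ?_
  rw [← prod_X_eq_monomial, ← Finset.prod_fiberwise (s := Finset.univ) (g := T)]
  refine Finset.prod_congr rfl fun i _ => ?_
  rw [Finset.prod_congr rfl (g := fun _ => (X i : MvPolynomial (Fin n) ℂ)), Finset.prod_const]
  intro b hb
  rw [(Finset.mem_filter.1 hb).2]

/-- The coefficients are numbers of fillings, so that nothing cancels. -/
lemma mem_support_skewSchur {m : Fin n →₀ ℕ} :
    m ∈ (skewSchur n lam mu).support ↔
      ∃ T : skewCells lam mu → Fin n, IsSemistandard T ∧ content T = m := by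
  classical
  rw [mem_support_iff, skewSchur_eq_sum_monomial, coeff_sum]
  simp only [coeff_monomial]
  rw [Finset.sum_boole, Nat.cast_ne_zero, Finset.card_ne_zero]
  simp only [Finset.Nonempty, Finset.mem_filter, Finset.mem_univ, true_and]

theorem trop_skewSchur :
    trop (skewSchur n lam mu) =
      ∏ j : Fin (lam.rowLen 0), tropEsymm Finset.univ (columnRows lam mu j).card := by
  classical
  simp only [tropEsymm]
  rw [Finset.prod_univ_sum, trop]
  refine sum_eq_sum_of_idempotent TropPoly.add_self ?_ ?_
  · intro m hm
    obtain ⟨T, hT, rfl⟩ := mem_support_skewSchur.1 hm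
    obtain ⟨S, hS, hprod⟩ := IsColumnStrict.exists_columnSets hT.2
    exact ⟨S, by simpa [Fintype.mem_piFinset, Finset.mem_powersetCard] using hS,
      by rw [← hprod, prod_X_eq_monomial]⟩
  · intro S hS
    obtain ⟨T, hT, hprod⟩ := exists_isColumnStrict S
      (by simpa [Fintype.mem_piFinset, Finset.mem_powersetCard] using hS)
    obtain ⟨σ, hrow, hsort⟩ := exists_perm_rowSorted T
    refine ⟨content (T ∘ σ),
      mem_support_skewSchur.2 ⟨_, hT.isSemistandard_comp hrow hsort, rfl⟩, ?_⟩
    rw [← hprod, ← prod_X_eq_monomial]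
    exact Equiv.prod_comp σ fun b => (X (T b) : TropPoly n)

/-- A column longer than `n` has no strictly increasing filling. -/
lemma card_columnRows_le (h : skewSchur n lam mu ≠ 0) (j : ℕ) :
    (columnRows lam mu j).card ≤ n := by
  obtain ⟨m, hm⟩ := support_nonempty.2 h
  obtain ⟨T, hT, -⟩ := mem_support_skewSchur.1 hm
  have hinj : Function.Injective fun r : columnRows lam mu j =>
      T ⟨(r.1, j), mem_columnRows.1 r.2⟩ :=
    StrictMono.injective fun r r' hrr' => hT.2 _ _ rfl hrr'
  simpa using Fintype.card_le_of_injective _ hinj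

end Fillings

lemma complexity_trop_skewSchur_le {n : ℕ} {lam mu : YoungDiagram}
    (h : skewSchur n lam mu ≠ 0) :
    complexity (trop (skewSchur n lam mu)) ≤ ((3 * n ^ 2 * lam.rowLen 0 : ℕ) : ℕ∞) := by
  rw [trop_skewSchur]
  -- If `n = 0` or `λ₁ = 0`, the bound is `0` and the polynomial is the constant `1`; otherwise both
  -- `2 n²` and `λ₁` are absorbed by multiples of `n² λ₁`.
  rcases Nat.eq_zero_or_pos n with rfl | hn
  · have hone : ∀ j : Fin (lam.rowLen 0),
        tropEsymm (Finset.univ : Finset (Fin 0)) (columnRows lam mu j).card = 1 := fun j => by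
      rw [Nat.le_zero.1 (card_columnRows_le h j), tropEsymm_zero]
    rw [Finset.prod_congr rfl fun j _ => hone j, Finset.prod_const_one]
    exact complexity_le_of_computable (Computable.empty.insert_one.mono (Nat.zero_le _) le_rfl)
      (Set.mem_insert _ _)
  rcases Nat.eq_zero_or_pos (lam.rowLen 0) with hl | hl
  · have : IsEmpty (Fin (lam.rowLen 0)) := by rw [hl]; infer_instance
    rw [Finset.univ_eq_empty, Finset.prod_empty]
    exact complexity_le_of_computable (Computable.empty.insert_one.mono (Nat.zero_le _) le_rfl)
      (Set.mem_insert _ _)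
  have hcomp := (computable_tropEsymm (Finset.univ : Finset (Fin n))).insert_prod
    (fun j : Fin (lam.rowLen 0) => tropEsymm Finset.univ (columnRows lam mu j).card)
    (fun j => ⟨_, by simpa using card_columnRows_le h j, rfl⟩)
  refine complexity_le_of_computable (hcomp.mono ?_ le_rfl) (Set.mem_insert _ _)
  have hn2 : 1 ≤ n ^ 2 := Nat.one_le_pow _ _ hn
  rw [Finset.card_univ, Fintype.card_fin]
  nlinarith [Nat.mul_le_mul hn2 hl]

end TropicalComplexity

theorem corollary1p5 :
    ∃ C : ℕ, ∀ (n : ℕ) (lam mu : YoungDiagram), mu ≤ lam →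
      TropicalComplexity.skewSchur n lam mu ≠ 0 →
      TropicalComplexity.complexity (TropicalComplexity.trop (TropicalComplexity.skewSchur n lam mu))
        ≤ ((C * n ^ 2 * lam.rowLen 0 : ℕ) : ℕ∞) :=
  ⟨3, fun _ _ _ _ h => TropicalComplexity.complexity_trop_skewSchur_le h⟩
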